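/- Let $\mathbb{D}=\{z\in\mathbb{C}:|z|<1\}$. For functions $F,G$ analytic in $\mathbb{D}$ write $F\prec G$ (subordination) if there is an analytic $w:\mathbb{D}\to\mathbb{D}$ with $w(0)=0$ and $F(z)=G(w(z))$ for all $z\in\mathbb{D}$. Let $\mathcal{S}^*_{Ne}$ be the class of functions $f$ analytic in $\mathbb{D}$ with $f(0)=0$, $f'(0)=1$ and $$\frac{zf'(z)}{f(z)}\prec 1+z-\frac{z^3}{3},$$ and let $f_{Ne}(z)=z\,e^{z-z^3/9}$. The quotients $zf'(z)/f(z)$ and $f(z)/z$ take the value $1$ at the removable singularity $z=0$, $\arg$ is the principal argument, and a rotation of $f_{Ne}$ is a function $z\mapsto e^{-i\theta}f_{Ne}(e^{i\theta}z)$ on $\mathbb{D}$ with $\theta\in\mathbb{R}$. **Theorem.** Let $f\in\mathcal{S}^*_{Ne}$. (i) (Subordination) $\dfrac{zf'(z)}{f(z)}\prec\dfrac{zf_{Ne}'(z)}{f_{Ne}(z)}$ and $\dfrac{f(z)}{z}\prec\dfrac{f_{Ne}(z)}{z}$. (ii) (Growth) If $|z|=r<1$, then $-f_{Ne}(-r)\le|f(z)|\le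 f_{Ne}(r)$. For every $r\in(0,1)$ and for each of the two inequalities, equality holds at some $z$ with $|z|=r$ if and only if $f$ is a rotation of $f_{Ne}$. (iii) (Covering) Either $f$ is a rotation of $f_{Ne}$, or $f(\mathbb{D})$ contains the disk $\{w:|w|<-f_{Ne}(-1)\}$, where $-f_{Ne}(-1)=e^{-8/9}$ and $|e^{-8/9}-0.411112|<10^{-6}$. (iv) (Rotation) If $|z|=r<1$, then $$\left|\arg\frac{f(z)}{z}\right|\le\max_{|\zeta|=r}\arg\frac{f_{Ne}(\zeta)}{\zeta},$$ the maximum being attained. For every $r\in(0,1)$, equality holds at some $z$ with $|z|=r$ if and only if $f$ is a rotation of $f_{Ne}$. -/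

import Mathlib

namespace Nephroid

open Complex Metric Set

/-- The open unit disk `𝔻` of the complex plane. -/
def disk : Set ℂ := ball 0 1

/-- The normalized class `𝒜`: functions analytic in the unit disk with `f 0 = 0` and
`f' 0 = 1`. Only the values of `f` on the disk matter. -/
def classA : Set (ℂ → ℂ) :=
  {f | DifferentiableOn ℂ f disk ∧ f 0 = 0 ∧ deriv f 0 = 1}

/-- Subordination `F ≺ G` of functions analytic in the unit disk: `F = G ∘ w` on the disk for
some analytic `w` with `w 0 = 0` and `|w| < 1` on the disk. -/
def Subordinate (F G : ℂ → ℂ) : Prop :=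
  DifferentiableOn ℂ F disk ∧ DifferentiableOn ℂ G disk ∧
    ∃ w : ℂ → ℂ, DifferentiableOn ℂ w disk ∧ w 0 = 0 ∧ (∀ z ∈ disk, ‖w z‖ < 1) ∧
      ∀ z ∈ disk, F z = G (w z)

/-- The function `z f'(z) / f(z)`, with its removable singularity at `0` filled in by the value
`1` (the limit there for every `f` in the class `𝒜`). -/
noncomputable def logDerivQuot (f : ℂ → ℂ) : ℂ → ℂ :=
  Function.update (fun z => z * deriv f z / f z) 0 1

/-- The function `f(z) / z`, with its removable singularity at `0` filled in by the value
`1` (the limit there for every `f` in the class `𝒜`). -/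
noncomputable def divId (f : ℂ → ℂ) : ℂ → ℂ :=
  Function.update (fun z => f z / z) 0 1

/-- The Ma-Minda class `𝒮*(φ)`: all `f` in `𝒜` with `z f'(z) / f(z) ≺ φ(z)`. A zero `z₀ ≠ 0` of
`f` in the disk is impossible for a member, as `z f'(z) / f(z)` is unbounded near `z₀`. -/
def starlikeClass (φ : ℂ → ℂ) : Set (ℂ → ℂ) :=
  {f | f ∈ classA ∧ Subordinate (logDerivQuot f) φ}

/-- The function `φ_Ne(z) = 1 + z - z³/3`, which maps the disk onto the nephroid domain. -/
noncomputable def phiNe (z : ℂ) : ℂ := 1 + z - z ^ 3 / 3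

/-- The class `𝒮*_Ne = 𝒮*(φ_Ne)`. -/
noncomputable def starlikeNe : Set (ℂ → ℂ) := starlikeClass phiNe

/-- The function `f_Ne(z) = z exp(z - z³/9)`. -/
noncomputable def fNe (z : ℂ) : ℂ := z * exp (z - z ^ 3 / 9)

/-- `f_Ne` is real on the real axis, so taking the real part there loses nothing. -/
theorem fNe_ofReal (x : ℝ) : fNe (x : ℂ) = ((x * Real.exp (x - x ^ 3 / 9) : ℝ) : ℂ) := by
  simp [fNe]

/-- `f` is, on the disk, a rotation `z ↦ e^{-iθ} g(e^{iθ} z)` of `g`. -/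
def IsRotationOf (f g : ℂ → ℂ) : Prop :=
  ∃ θ : ℝ, ∀ z ∈ disk, f z = exp (-(θ * I)) * g (exp (θ * I) * z)

end Nephroid

namespace Nephroid

open Complex Metric Set Filter Topology

/-! Write `f z / z = exp (h z)`. Membership in the class becomes `z h' = w - w³/3` with `w` a
Schwarz function, and `fNe` is the case `h = hNe`, `w z = z`. The heart of the matter is that `h =
hNe ∘ v` for another Schwarz function `v`. As `hNe` is injective beyond the unit disk, this means
that `h` never leaves `hNe '' ball 0 1`. At a first exit point `z₀`, `v = hNe⁻¹ ∘ h` has modulus 1,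
and Jack's lemma gives `z₀ h'(z₀) = m (ζ - ζ³/3)` with `m ≥ 1`, `‖ζ‖ = 1`. An explicit sextic
separates such points from the values `w - w³/3` (`nephroid_lt`, `nephroid_ge`), a contradiction.

The bounds then follow from `‖v z‖ ≤ ‖z‖` and sharp estimates of the real and imaginary parts of
`hNe`. These increase strictly with the modulus, so equality forces `‖v z‖ = ‖z‖`, hence `v` is a
rotation. Covering follows from the lower growth bound, the open mapping theorem and connectedness.
-/

/-- The primitive of `(phiNe z - 1) / z` vanishing at `0`, so that `fNe z = z * exp (hNe z)`. -/
noncomputable def hNe (z : ℂ) : ℂ := z - z ^ 3 / 9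

/-! ### The sextic inequality of the nephroid, translated to centre 0 -/

/-- Points `w` of the disk satisfy the strict implicit inequality of the nephroid. -/
lemma nephroid_lt {w : ℂ} (hw : ‖w‖ < 1) :
    (normSq (w - w ^ 3 / 3) - 4 / 9) ^ 3 < 4 / 3 * (w - w ^ 3 / 3).im ^ 2 := by
  obtain ⟨x, y⟩ := w
  have ha : x ^ 2 + y ^ 2 < 1 := by
    have h := Complex.normSq_eq_norm_sq ⟨x, y⟩
    have h2 : ‖(⟨x, y⟩ : ℂ)‖ ^ 2 < 1 := by
      rw [sq_lt_one_iff₀ (norm_nonneg _)]; exact hw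
    rw [← h, normSq_mk] at h2
    nlinarith
  have hre : ((⟨x, y⟩ : ℂ) - (⟨x, y⟩ : ℂ) ^ 3 / 3).re = x - (x ^ 3 - 3 * x * y ^ 2) / 3 := by
    simp [pow_succ]; ring
  have him : ((⟨x, y⟩ : ℂ) - (⟨x, y⟩ : ℂ) ^ 3 / 3).im = y * (1 - (x ^ 2 + y ^ 2) + 4 * y ^ 2 / 3) := by
    simp [pow_succ]; ring
  rw [normSq_apply, hre, him]
  set k := 4 * y ^ 2 / 3 with hk
  set b := 1 - (x ^ 2 + y ^ 2) with hb
  have hk0 : 0 ≤ k := by positivity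
  have hb0 : 0 < b := by linarith
  -- The curve is `(|u|² - 4/9)³ = (4/3)(Im u)²`. In the variables `b`, `k` its two sides become
  -- comparable with `k³`, with equality at `b = 0`.
  have hX : (x - (x ^ 3 - 3 * x * y ^ 2) / 3) * (x - (x ^ 3 - 3 * x * y ^ 2) / 3) +
      y * (b + k) * (y * (b + k)) - 4 / 9 = (1 - b) * k - b ^ 2 * (3 + b) / 9 := by
    rw [hk, hb]; ring
  rw [hX]
  have h1 : (1 - b) * k - b ^ 2 * (3 + b) / 9 < k := by
    have := mul_nonneg hb0.le hk0
    have : 0 < b ^ 2 * (3 + b) / 9 := by positivity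
    nlinarith
  have h2 : ((1 - b) * k - b ^ 2 * (3 + b) / 9) ^ 3 < k ^ 3 :=
    (Odd.strictMono_pow (by decide)) h1
  have h3 : 4 / 3 * (y * (b + k)) ^ 2 = k * (b + k) ^ 2 := by rw [hk]; ring
  have h4 : k ^ 3 ≤ k * (b + k) ^ 2 := by
    have : 0 ≤ k * (b * (b + 2 * k)) := by positivity
    nlinarith
  rw [h3]
  exact h2.trans_le h4

/-- Outward multiples of nephroid boundary points stay outside the nephroid domain. -/
lemma nephroid_ge {w : ℂ} (hw : ‖w‖ = 1) {m : ℝ} (hm : 1 ≤ m) :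
    4 / 3 * (m * (w - w ^ 3 / 3)).im ^ 2 ≤ (normSq (m * (w - w ^ 3 / 3)) - 4 / 9) ^ 3 := by
  obtain ⟨x, y⟩ := w
  have ha : x ^ 2 = 1 - y ^ 2 := by
    have h := Complex.normSq_eq_norm_sq ⟨x, y⟩
    rw [hw, normSq_mk] at h
    linarith
  have hre : ((⟨x, y⟩ : ℂ) - (⟨x, y⟩ : ℂ) ^ 3 / 3).re = x * (1 - (x ^ 2 - 3 * y ^ 2) / 3) := by
    simp [pow_succ]; ring
  have him : ((⟨x, y⟩ : ℂ) - (⟨x, y⟩ : ℂ) ^ 3 / 3).im = 4 / 3 * y ^ 3 := by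
    have : ((⟨x, y⟩ : ℂ) - (⟨x, y⟩ : ℂ) ^ 3 / 3).im = y - (3 * x ^ 2 * y - y ^ 3) / 3 := by
      simp [pow_succ]; ring
    rw [this, ha]; ring
  have hn : normSq ((⟨x, y⟩ : ℂ) - (⟨x, y⟩ : ℂ) ^ 3 / 3) = 4 / 9 + 4 / 3 * y ^ 2 := by
    rw [normSq_apply, hre, him,
      show ∀ c : ℝ, x * c * (x * c) = x ^ 2 * c ^ 2 from fun c => by ring, ha]
    ring
  rw [normSq_mul, hn, normSq_ofReal, Complex.im_ofReal_mul, him]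
  have hm2 : 1 ≤ m ^ 2 := one_le_pow₀ hm
  have h1 : m ^ 2 * (4 / 3 * y ^ 2) ≤ m * m * (4 / 9 + 4 / 3 * y ^ 2) - 4 / 9 := by nlinarith
  have h2 := pow_le_pow_left₀ (by positivity) h1 3
  refine le_trans ?_ h2
  -- At `m = 1` there is equality; scaling by `m` multiplies the left side by `m²` and the right
  -- side by at least `m⁶`.
  have h3 : m ^ 2 ≤ (m ^ 2) ^ 3 := le_self_pow₀ hm2 (by norm_num)
  calc 4 / 3 * (m * (4 / 3 * y ^ 3)) ^ 2 = m ^ 2 * (4 / 3 * y ^ 2) ^ 3 := by ring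
    _ ≤ (m ^ 2) ^ 3 * (4 / 3 * y ^ 2) ^ 3 := by gcongr
    _ = _ := by ring

lemma nephroid_ne {w ζ : ℂ} (hw : ‖w‖ < 1) (hζ : ‖ζ‖ = 1) {m : ℝ} (hm : 1 ≤ m) :
    w - w ^ 3 / 3 ≠ m * (ζ - ζ ^ 3 / 3) := fun h => by
  have h1 := nephroid_lt hw
  rw [h] at h1
  exact absurd (nephroid_ge hζ hm) (not_le.2 h1)

/-! ### Boundary maxima -/

/-- **Jack's lemma**. -/
lemma exists_real_mul_deriv_of_norm_le {v : ℂ → ℂ} {z₀ v' : ℂ}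
    (hd : DifferentiableOn ℂ v (ball 0 ‖z₀‖)) (h0 : v 0 = 0) (hv' : HasDerivAt v v' z₀)
    (hle : ∀ z, ‖z‖ ≤ ‖z₀‖ → ‖v z‖ ≤ 1) (hz₀ : ‖v z₀‖ = 1) :
    ∃ m : ℝ, 1 ≤ m ∧ z₀ * v' = m * v z₀ := by
  have hne : z₀ ≠ 0 := by
    rintro rfl; simp [h0] at hz₀
  have hpos : 0 < ‖z₀‖ := norm_pos_iff.2 hne
  set A := z₀ * v' * (starRingEnd ℂ) (v z₀) with hA
  -- Along the circle through `z₀`, `‖v‖²` is maximal at `z₀`, so its angular derivative vanishes.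
  have him : A.im = 0 := by
    have hγ : HasDerivAt (fun t : ℝ => v (z₀ * exp (t * I))) (v' * (z₀ * I)) 0 := by
      have h1 : HasDerivAt (fun t : ℂ => z₀ * exp (t * I)) (z₀ * I) ((0 : ℝ) : ℂ) := by
        have := (((hasDerivAt_id (((0 : ℝ) : ℂ))).mul_const I).cexp).const_mul z₀
        simpa using this
      have h2 : HasDerivAt v v' (z₀ * exp (((0 : ℝ) : ℂ) * I)) := by simpa using hv'
      exact (HasDerivAt.comp (((0 : ℝ) : ℂ)) (h₂ := v) h2 h1).comp_ofReal
    have hsq := hγ.norm_sq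
    have hmax : IsLocalMax (fun t : ℝ => ‖v (z₀ * exp (t * I))‖ ^ 2) 0 := by
      refine Eventually.of_forall fun t => ?_
      have : ‖v (z₀ * exp (t * I))‖ ≤ 1 := hle _ (by simp [norm_exp_ofReal_mul_I])
      simpa [hz₀] using this
    have h := hmax.hasDerivAt_eq_zero hsq
    simp only [ofReal_zero, zero_mul, Complex.exp_zero, mul_one, Complex.inner] at h
    have h2 : (A * I).re = 0 := by
      rw [hA]
      have : z₀ * v' * (starRingEnd ℂ) (v z₀) * I = v' * (z₀ * I) * (starRingEnd ℂ) (v z₀) := by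
        ring
      rw [this]; linarith
    simpa using h2
  -- By the Schwarz lemma `‖v (t z₀)‖² - t² ≤ 0` for `0 < t < 1`, with equality at `t = 1`, so the
  -- left derivative `2 A.re - 2` is nonnegative.
  have hre : 1 ≤ A.re := by
    have hγ : HasDerivAt (fun t : ℝ => v (t * z₀)) (v' * z₀) 1 := by
      have h1 : HasDerivAt (fun t : ℂ => t * z₀) z₀ ((1 : ℝ) : ℂ) := by
        simpa using (hasDerivAt_id (((1 : ℝ) : ℂ))).mul_const z₀
      have h2 : HasDerivAt v v' (((1 : ℝ) : ℂ) * z₀) := by simpa using hv'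
      exact (HasDerivAt.comp (((1 : ℝ) : ℂ)) (h₂ := v) h2 h1).comp_ofReal
    have hF := hγ.norm_sq.sub ((hasDerivAt_id (1 : ℝ)).pow 2)
    have hs := (hasDerivAt_iff_tendsto_slope.1 hF).mono_left
      (nhdsWithin_mono (1 : ℝ) (fun t (ht : t ∈ Iio (1 : ℝ)) => ne_of_lt ht))
    have hge := ge_of_tendsto hs (b := 0) (by
      filter_upwards [Ioo_mem_nhdsLT (show (0 : ℝ) < 1 by norm_num)] with t ht
      have hb : ‖v (t * z₀)‖ ≤ t := by
        have hmem : (t : ℂ) * z₀ ∈ ball (0 : ℂ) ‖z₀‖ := by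
          simp only [mem_ball_zero_iff, norm_mul, norm_real, Real.norm_eq_abs, abs_of_pos ht.1]
          nlinarith [ht.2]
        have := dist_le_div_mul_dist_of_mapsTo_ball (R₂ := 1) hd (fun z hz => by
          rw [h0]; simpa using hle z (mem_ball_zero_iff.1 hz).le) hmem
        simp only [h0, dist_zero_right, norm_mul, norm_real, Real.norm_eq_abs, abs_of_pos ht.1]
          at this
        refine this.trans_eq ?_
        field_simp
      have h2 := pow_le_pow_left₀ (norm_nonneg _) hb 2
      rw [slope_def_field]
      apply div_nonneg_of_nonpos
      · simp [hz₀]; linarith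
      · linarith [ht.2])
    simp only [ofReal_one, one_mul, Complex.inner, id] at hge
    have : (v' * z₀ * (starRingEnd ℂ) (v z₀)).re = A.re := by rw [hA, mul_comm v']
    rw [this] at hge
    norm_num at hge
    linarith
  refine ⟨A.re, hre, ?_⟩
  have hAre : (A.re : ℂ) = A := Complex.ext (by simp) (by simp [him])
  have hone : (starRingEnd ℂ) (v z₀) * v z₀ = 1 := by
    rw [← normSq_eq_conj_mul_self, normSq_eq_norm_sq, hz₀]; simp
  rw [hAre, hA, mul_assoc, hone, mul_one]

/-! ### Univalence of `hNe` and the subordination argument -/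

lemma hasDerivAt_hNe (z : ℂ) : HasDerivAt hNe (1 - z ^ 2 / 3) z := by
  have := (hasDerivAt_id z).sub (((hasDerivAt_id z).pow 3).div_const 9)
  refine this.congr_deriv ?_
  simp; ring

lemma differentiable_hNe : Differentiable ℂ hNe := fun z => (hasDerivAt_hNe z).differentiableAt

/-- The difference quotient vanishes only if `a² + ab + b² = 9`, impossible for radius up to `√3`. A
radius above 1 makes the inverse analytic across the image of the unit circle, where Jack's lemma is
applied. -/
lemma injOn_hNe : InjOn hNe (ball 0 (3 / 2)) := by
  intro a ha b hb h
  rw [mem_ball_zero_iff] at ha hb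
  have h1 : (a - b) * (9 - (a ^ 2 + a * b + b ^ 2)) = 0 := by
    simp only [hNe] at h; linear_combination 9 * h
  rcases mul_eq_zero.1 h1 with h2 | h2
  · exact sub_eq_zero.1 h2
  · exfalso
    have h3 : ‖a ^ 2 + a * b + b ^ 2‖ ≤ ‖a‖ ^ 2 + ‖a‖ * ‖b‖ + ‖b‖ ^ 2 := by
      refine (norm_add₃_le).trans ?_
      simp
    rw [← sub_eq_zero.1 h2] at h3
    norm_num at h3
    nlinarith [norm_nonneg a, norm_nonneg b]

lemma hNe_deriv_ne_zero {z : ℂ} (hz : ‖z‖ < 3 / 2) : 1 - z ^ 2 / 3 ≠ 0 := by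
  intro h
  have h2 : z ^ 2 = 3 := by linear_combination -3 * h
  have h3 : ‖z‖ ^ 2 = 3 := by rw [← norm_pow, h2]; simp
  nlinarith [norm_nonneg z]

/-- The inverse of `hNe` on the disk of radius `3 / 2`. -/
noncomputable def hNeInv : ℂ → ℂ := Function.invFunOn hNe (ball 0 (3 / 2))

lemma hNeInv_hNe {z : ℂ} (hz : ‖z‖ < 3 / 2) : hNeInv (hNe z) = z :=
  injOn_hNe.leftInvOn_invFunOn (mem_ball_zero_iff.2 hz)

lemma hasDerivAt_hNeInv {z : ℂ} (hz : ‖z‖ < 3 / 2) :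
    HasDerivAt hNeInv (1 - z ^ 2 / 3)⁻¹ (hNe z) := by
  have hs : HasStrictDerivAt hNe (1 - z ^ 2 / 3) z := by
    have := (differentiable_hNe.analyticAt z).hasStrictDerivAt
    rwa [(hasDerivAt_hNe z).deriv] at this
  refine (hs.to_local_left_inverse (hNe_deriv_ne_zero hz) ?_).hasDerivAt
  filter_upwards [isOpen_ball.mem_nhds (mem_ball_zero_iff.2 hz)] with x hx
  exact hNeInv_hNe (mem_ball_zero_iff.1 hx)

lemma isOpen_hNe_image : IsOpen (hNe '' ball 0 1) := by
  rw [isOpen_iff_mem_nhds]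
  rintro _ ⟨z, hz, rfl⟩
  have hs : HasStrictDerivAt hNe (1 - z ^ 2 / 3) z := by
    have := (differentiable_hNe.analyticAt z).hasStrictDerivAt
    rwa [(hasDerivAt_hNe z).deriv] at this
  rw [← hs.map_nhds_eq (hNe_deriv_ne_zero (by rw [mem_ball_zero_iff] at hz; linarith))]
  exact image_mem_map (isOpen_ball.mem_nhds hz)

/-- A function whose logarithmic derivative quotient is subordinate to the nephroid map takes its
values in the image of `hNe`. -/
lemma mem_hNe_image {h w : ℂ → ℂ} (hd : DifferentiableOn ℂ h (ball 0 1)) (h0 : h 0 = 0)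
    (hw : ∀ z ∈ ball (0 : ℂ) 1, ‖w z‖ < 1)
    (hode : ∀ z ∈ ball (0 : ℂ) 1, z * deriv h z = w z - w z ^ 3 / 3) {z : ℂ}
    (hz : z ∈ ball (0 : ℂ) 1) : h z ∈ hNe '' ball 0 1 := by
  by_contra hcon
  rw [mem_ball_zero_iff] at hz
  have hcont := hd.continuousOn
  have hsub : closedBall (0 : ℂ) ‖z‖ ⊆ ball 0 1 := closedBall_subset_ball hz
  have hK : IsCompact (closedBall (0 : ℂ) ‖z‖ ∩ h ⁻¹' (hNe '' ball 0 1)ᶜ) := by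
    refine (isCompact_closedBall _ _).of_isClosed_subset ?_ inter_subset_left
    exact (hcont.mono hsub).preimage_isClosed_of_isClosed isClosed_closedBall
      isOpen_hNe_image.isClosed_compl
  -- A first exit point: of least modulus among those mapped outside the image.
  obtain ⟨z₀, hz₀, hmin⟩ := hK.exists_isMinOn ⟨z, by simp, hcon⟩ continuous_norm.continuousOn
  have hz₀z : ‖z₀‖ ≤ ‖z‖ := mem_closedBall_zero_iff.1 hz₀.1
  have hin : ∀ y, ‖y‖ < ‖z₀‖ → h y ∈ hNe '' ball 0 1 := fun y hy => by
    by_contra hy'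
    exact absurd (hmin ⟨mem_closedBall_zero_iff.2 (by linarith), hy'⟩) (not_le.2 hy)
  have hz₀0 : z₀ ≠ 0 := by
    rintro rfl
    exact hz₀.2 ⟨0, by simp, by simp [hNe, h0]⟩
  have hcl : ∀ y, ‖y‖ ≤ ‖z₀‖ → ∃ ζ, ‖ζ‖ ≤ 1 ∧ hNe ζ = h y := fun y hy => by
    have hy' : y ∈ closure (ball (0 : ℂ) ‖z₀‖) := by
      rw [closure_ball _ (norm_ne_zero_iff.2 hz₀0)]; simpa using hy
    have hc : ContinuousWithinAt h (ball (0 : ℂ) ‖z₀‖) y :=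
      (hcont y (mem_ball_zero_iff.2 (by linarith))).mono (ball_subset_ball (by linarith))
    have := hc.mem_closure hy' (t := hNe '' closedBall 0 1) (fun x hx =>
      image_mono ball_subset_closedBall (hin x (mem_ball_zero_iff.1 hx)))
    rw [((isCompact_closedBall _ _).image differentiable_hNe.continuous).isClosed.closure_eq]
      at this
    obtain ⟨ζ, hζ, h2⟩ := this
    exact ⟨ζ, by simpa using hζ, h2⟩
  have hderiv : ∀ y, ‖y‖ ≤ ‖z₀‖ → ∃ ζ, ‖ζ‖ ≤ 1 ∧ hNe ζ = h y ∧ hNeInv (h y) = ζ ∧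
      HasDerivAt (hNeInv ∘ h) ((1 - ζ ^ 2 / 3)⁻¹ * deriv h y) y := fun y hy => by
    obtain ⟨ζ, h1, h2⟩ := hcl y hy
    have h3 : ‖ζ‖ < 3 / 2 := by linarith
    refine ⟨ζ, h1, h2, by rw [← h2, hNeInv_hNe h3], ?_⟩
    have h4 := hasDerivAt_hNeInv h3
    rw [h2] at h4
    exact h4.comp y (hd.differentiableAt (isOpen_ball.mem_nhds
      (mem_ball_zero_iff.2 (by linarith)))).hasDerivAt
  obtain ⟨ζ, hζ1, hζh, hζi, hζd⟩ := hderiv z₀ le_rfl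
  have hζ : ‖ζ‖ = 1 := by
    refine le_antisymm hζ1 (not_lt.1 fun hlt => hz₀.2 ⟨ζ, by simpa using hlt, hζh⟩)
  obtain ⟨m, hm, hmeq⟩ := exists_real_mul_deriv_of_norm_le (v := hNeInv ∘ h) (z₀ := z₀)
    (fun y hy => by
      obtain ⟨_, _, _, _, h5⟩ := hderiv y (mem_ball_zero_iff.1 hy).le
      exact h5.differentiableAt.differentiableWithinAt)
    (by
      have := hNeInv_hNe (z := 0) (by simp)
      simpa [hNe, h0] using this) hζd
    (fun y hy => by
      obtain ⟨ξ, h1, _, h3, _⟩ := hderiv y hy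
      simpa [h3] using h1)
    (by simp [hζi, hζ])
  have hz₀1 : z₀ ∈ ball (0 : ℂ) 1 := mem_ball_zero_iff.2 (by linarith)
  refine nephroid_ne (hw z₀ hz₀1) hζ hm ?_
  rw [← hode z₀ hz₀1]
  have hne := hNe_deriv_ne_zero (show ‖ζ‖ < 3 / 2 by linarith)
  simp only [Function.comp, hζi] at hmeq
  have h6 : z₀ * deriv h z₀ = (1 - ζ ^ 2 / 3) * (z₀ * ((1 - ζ ^ 2 / 3)⁻¹ * deriv h z₀)) := by
    rw [mul_left_comm z₀, mul_inv_cancel_left₀ hne]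
  rw [h6, hmeq]; ring

lemma exists_hNe_comp {h w : ℂ → ℂ} (hd : DifferentiableOn ℂ h (ball 0 1)) (h0 : h 0 = 0)
    (hw : ∀ z ∈ ball (0 : ℂ) 1, ‖w z‖ < 1)
    (hode : ∀ z ∈ ball (0 : ℂ) 1, z * deriv h z = w z - w z ^ 3 / 3) :
    ∃ v : ℂ → ℂ, DifferentiableOn ℂ v (ball 0 1) ∧ v 0 = 0 ∧
      (∀ z ∈ ball (0 : ℂ) 1, ‖v z‖ < 1) ∧ ∀ z ∈ ball (0 : ℂ) 1, h z = hNe (v z) := by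
  have key : ∀ z ∈ ball (0 : ℂ) 1, ∃ ζ, ‖ζ‖ < 1 ∧ hNe ζ = h z ∧ hNeInv (h z) = ζ := fun z hz => by
    obtain ⟨ζ, h1, h2⟩ := mem_hNe_image hd h0 hw hode hz
    rw [mem_ball_zero_iff] at h1
    exact ⟨ζ, h1, h2, by rw [← h2, hNeInv_hNe (by linarith)]⟩
  refine ⟨hNeInv ∘ h, fun z hz => ?_, ?_, fun z hz => ?_, fun z hz => ?_⟩
  · obtain ⟨ζ, h1, h2, h3⟩ := key z hz
    have h4 := hasDerivAt_hNeInv (show ‖ζ‖ < 3 / 2 by linarith)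
    rw [h2] at h4
    exact h4.differentiableAt.comp_differentiableWithinAt z (hd z hz)
  · have := hNeInv_hNe (z := 0) (by simp)
    simpa [hNe, h0] using this
  · obtain ⟨ζ, h1, h2, h3⟩ := key z hz
    simpa [h3] using h1
  · obtain ⟨ζ, h1, h2, h3⟩ := key z hz
    simp [h3, h2]

/-! ### The logarithm of `f z / z` and the Schwarz representation -/

lemma divId_eq_dslope {f : ℂ → ℂ} (hf : f ∈ classA) : divId f = dslope f 0 := by
  ext z
  rcases eq_or_ne z 0 with rfl | hz
  · simp [divId, hf.2.2]
  · simp [divId, hz, dslope_of_ne, slope_def_field, hf.2.1]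

lemma differentiableOn_divId {f : ℂ → ℂ} (hf : f ∈ classA) :
    DifferentiableOn ℂ (divId f) disk := by
  rw [divId_eq_dslope hf]
  exact (differentiableOn_dslope (ball_mem_nhds 0 one_pos)).2 hf.1

lemma mul_divId {f : ℂ → ℂ} (h0 : f 0 = 0) (z : ℂ) : z * divId f z = f z := by
  rcases eq_or_ne z 0 with rfl | hz
  · simp [h0]
  · simp [divId, hz, mul_div_cancel₀]

/-- If `z f'(z) / f(z)` is analytic in the disk, then `f` vanishes only at the origin. -/
lemma ne_zero_of_differentiableOn_logDerivQuot {f : ℂ → ℂ} (hf : f ∈ classA)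
    (hq : DifferentiableOn ℂ (logDerivQuot f) disk) {z : ℂ} (hz : z ∈ disk) (hz0 : z ≠ 0) :
    f z ≠ 0 := by
  intro hfz
  have hA : AnalyticOnNhd ℂ f disk := hf.1.analyticOnNhd isOpen_ball
  have hfa := hA z hz
  have hqa : AnalyticAt ℂ (logDerivQuot f) z := hq.analyticOnNhd isOpen_ball z hz
  have htop : analyticOrderAt f z ≠ ⊤ := by
    intro h
    have h1 := hA.eqOn_zero_of_preconnected_of_eventuallyEq_zero
      (convex_ball (0 : ℂ) 1).isPreconnected hz (analyticOrderAt_eq_top.1 h)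
    have h2 : f =ᶠ[𝓝 0] fun _ => 0 := h1.eventuallyEq_of_mem (ball_mem_nhds 0 one_pos)
    have h3 := h2.deriv_eq
    rw [hf.2.2] at h3
    simp at h3
  have hev : ∀ᶠ y in 𝓝[≠] z, (logDerivQuot f * f) y = ((id : ℂ → ℂ) * deriv f) y := by
    have h1 : ∀ᶠ y in 𝓝[≠] z, f y ≠ 0 := by
      rcases hfa.eventually_eq_zero_or_eventually_ne_zero with h | h
      · exact absurd (analyticOrderAt_eq_top.2 h) htop
      · exact h
    filter_upwards [h1, (isOpen_ne.mem_nhds hz0 : {y : ℂ | y ≠ 0} ∈ 𝓝 z) |> mem_nhdsWithin_of_mem_nhds]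
      with y hy hy0
    have : y ≠ 0 := hy0
    simp [logDerivQuot, this, div_mul_cancel₀ _ hy]
  -- The identity may fail at the zero `z` itself, where division by zero intervenes; analyticity
  -- restores it. Then the left side vanishes to at least the order of `f`, the right side to one
  -- order less.
  have hev' : logDerivQuot f * f =ᶠ[𝓝 z] (id : ℂ → ℂ) * deriv f :=
    ((hqa.mul hfa).frequently_eq_iff_eventually_eq (analyticAt_id.mul hfa.deriv)).1 hev.frequently
  have hord := analyticOrderAt_congr hev'
  rw [analyticOrderAt_mul hqa hfa, analyticOrderAt_mul analyticAt_id hfa.deriv] at hord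
  have hid : analyticOrderAt (id : ℂ → ℂ) z = 0 := analyticAt_id.analyticOrderAt_eq_zero.2 hz0
  have hd := hfa.analyticOrderAt_deriv_add_one
  simp only [hfz, sub_zero] at hd
  rw [← hd] at hord htop
  obtain ⟨n, hn⟩ := ENat.ne_top_iff_exists.1 (fun h => htop (by rw [h]; rfl) :
    analyticOrderAt (deriv f) z ≠ ⊤)
  rw [hid, ← hn, zero_add] at hord
  have h5 : ((n : ℕ∞) + 1) ≤ n := by
    calc ((n : ℕ∞) + 1) ≤ analyticOrderAt (logDerivQuot f) z + (n + 1) := le_add_self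
      _ = n := hord
  have : n + 1 ≤ n := by exact_mod_cast h5
  omega

lemma differentiableAt_of_mem_disk {g : ℂ → ℂ} (hg : DifferentiableOn ℂ g disk) {z : ℂ}
    (hz : z ∈ disk) : DifferentiableAt ℂ g z := hg.differentiableAt (isOpen_ball.mem_nhds hz)

/-- An analytic logarithm of a function without zeros in the disk. -/
lemma exists_exp_eq {g : ℂ → ℂ} (hg : DifferentiableOn ℂ g disk) (h0 : g 0 = 1)
    (hne : ∀ z ∈ disk, g z ≠ 0) :
    ∃ h : ℂ → ℂ, DifferentiableOn ℂ h disk ∧ h 0 = 0 ∧ (∀ z ∈ disk, g z = exp (h z)) ∧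
      ∀ z ∈ disk, deriv h z = deriv g z / g z := by
  have hd : DifferentiableOn ℂ (fun z => deriv g z / g z) (ball 0 1) :=
    (hg.deriv isOpen_ball).div hg hne
  obtain ⟨h, hh0, hh⟩ := hd.isExactOn_ball.with_val_at 0 0
  have hmem0 : (0 : ℂ) ∈ disk := mem_ball_self one_pos
  refine ⟨h, fun z hz => (hh z hz).differentiableAt.differentiableWithinAt, hh0, fun z hz => ?_,
    fun z hz => (hh z hz).deriv⟩
  have hconst : ∀ y ∈ disk, HasDerivAt (fun y => g y * exp (-h y)) 0 y := fun y hy => by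
    have h1 := (differentiableAt_of_mem_disk hg hy).hasDerivAt.mul (hh y hy).neg.cexp
    refine h1.congr_deriv ?_
    have := hne y hy
    field_simp
    ring
  have h2 := isOpen_ball.is_const_of_deriv_eq_zero (convex_ball (0 : ℂ) 1).isPreconnected
    (fun y hy => (hconst y hy).differentiableAt.differentiableWithinAt)
    (fun y hy => (hconst y hy).deriv) hz hmem0
  simp only [h0, hh0, neg_zero, Complex.exp_zero, mul_one] at h2
  rw [Complex.exp_neg] at h2
  have := Complex.exp_ne_zero (h z)
  field_simp at h2
  exact h2

lemma logDerivQuot_fNe (z : ℂ) (hz : z ∈ disk) : logDerivQuot fNe z = phiNe z := by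
  rcases eq_or_ne z 0 with rfl | hz0
  · simp [logDerivQuot, phiNe]
  · have h1 : HasDerivAt fNe (1 * exp (hNe z) + z * (exp (hNe z) * (1 - z ^ 2 / 3))) z :=
      (hasDerivAt_id z).mul (hasDerivAt_hNe z).cexp
    have h2 : fNe z = z * exp (hNe z) := rfl
    have := Complex.exp_ne_zero (hNe z)
    simp only [logDerivQuot, Function.update_of_ne hz0, h1.deriv, h2, phiNe]
    field_simp
    ring

lemma divId_fNe (z : ℂ) : divId fNe z = exp (hNe z) := by
  rcases eq_or_ne z 0 with rfl | hz0
  · simp [divId, hNe]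
  · simp [divId, hz0, fNe, hNe, mul_div_cancel_left₀]

/-- Members of the nephroid class have the form `z * exp (hNe (v z))` with a Schwarz function
`v`. -/
lemma exists_schwarz {f : ℂ → ℂ} (hf : f ∈ starlikeNe) :
    ∃ v : ℂ → ℂ, DifferentiableOn ℂ v disk ∧ v 0 = 0 ∧ (∀ z ∈ disk, ‖v z‖ < 1) ∧
      ∀ z ∈ disk, divId f z = exp (hNe (v z)) := by
  obtain ⟨hA, hq, -, w, -, hw0, hw1, hfw⟩ := hf
  have hg := differentiableOn_divId hA
  have hne : ∀ z ∈ disk, divId f z ≠ 0 := fun z hz => by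
    rcases eq_or_ne z 0 with rfl | hz0
    · simp [divId]
    · simpa [divId, hz0] using ne_zero_of_differentiableOn_logDerivQuot hA hq hz hz0
  obtain ⟨h, hd, h0, hexp, hder⟩ := exists_exp_eq hg (by simp [divId]) hne
  obtain ⟨v, hv, hv0, hv1, hhv⟩ := exists_hNe_comp (w := w) hd h0 hw1 (fun z hz => by
    rcases eq_or_ne z 0 with rfl | hz0
    · simp [hw0]
    have h1 := hfw z hz
    have h2 : HasDerivAt f (1 * divId f z + z * deriv (divId f) z) z := by
      have := (hasDerivAt_id z).mul (differentiableAt_of_mem_disk hg hz).hasDerivAt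
      refine this.congr_of_eventuallyEq (Eventually.of_forall fun y => ?_)
      exact (mul_divId hA.2.1 y).symm
    simp only [logDerivQuot, Function.update_of_ne hz0, h2.deriv, phiNe] at h1
    rw [hder z hz]
    rw [← mul_divId hA.2.1 z] at h1
    have := hne z hz
    have h3 : z * (1 * divId f z + z * deriv (divId f) z) / (z * divId f z) =
        1 + z * (deriv (divId f) z / divId f z) := by field_simp
    rw [h3] at h1
    linear_combination h1)
  exact ⟨v, hv, hv0, hv1, fun z hz => by rw [hexp z hz, hhv z hz]⟩

/-- The equality case of the Schwarz lemma, for functions of the form `z * exp (hNe (v z))`. -/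
lemma isRotationOf_of_norm_eq {f v : ℂ → ℂ} (h0 : f 0 = 0) (hv : DifferentiableOn ℂ v disk)
    (hv0 : v 0 = 0) (hv1 : ∀ z ∈ disk, ‖v z‖ < 1)
    (hfv : ∀ z ∈ disk, divId f z = exp (hNe (v z))) {z : ℂ} (hz : z ∈ disk) (hz0 : z ≠ 0)
    (heq : ‖v z‖ = ‖z‖) : IsRotationOf f fNe := by
  have hdn : ‖dslope v 0 z‖ = 1 := by
    rw [dslope_of_ne _ hz0, slope_def_field]
    simp [hv0, heq, hz0]
  have haff := affine_of_mapsTo_ball_of_norm_dslope_eq_div (R₁ := 1) (R₂ := 1) hv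
    (fun y hy => by rw [hv0]; simpa using (hv1 y hy).le) hz (by simpa using hdn)
  set c := dslope v 0 z with hc
  refine ⟨arg c, fun y hy => ?_⟩
  have hexp : exp (arg c * I) = c := by
    have := norm_mul_exp_arg_mul_I c
    rwa [hdn, ofReal_one, one_mul] at this
  have hvy : v y = c * y := by
    have := haff hy
    simp [hv0] at this
    rw [this, mul_comm]
  rw [← mul_divId h0 y, hfv y hy, hvy, Complex.exp_neg, hexp, fNe]
  have hc0 : c ≠ 0 := by rw [← norm_ne_zero_iff, hdn]; exact one_ne_zero
  simp only [hNe]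
  field_simp

lemma IsRotationOf.exists_divId {f : ℂ → ℂ} (h : IsRotationOf f fNe) :
    ∃ c : ℂ, ‖c‖ = 1 ∧ ∀ z ∈ disk, divId f z = exp (hNe (c * z)) := by
  obtain ⟨θ, h⟩ := h
  refine ⟨exp (θ * I), norm_exp_ofReal_mul_I θ, fun z hz => ?_⟩
  rcases eq_or_ne z 0 with rfl | hz0
  · simp [divId, hNe]
  · simp only [divId, Function.update_of_ne hz0, h z hz, fNe, hNe, Complex.exp_neg]
    have := Complex.exp_ne_zero (θ * I)
    field_simp

/-! ### Sharp bounds for `hNe` -/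

lemma hNe_neg (z : ℂ) : hNe (-z) = -hNe z := by simp only [hNe]; ring

lemma hNe_ofReal_re (r : ℝ) : (hNe r).re = r - r ^ 3 / 9 := by
  have : hNe r = ((r - r ^ 3 / 9 : ℝ) : ℂ) := by simp [hNe]
  rw [this, ofReal_re]

lemma hNe_mul_I_im (r : ℝ) : (hNe (r * I)).im = r + r ^ 3 / 9 := by
  have : hNe (r * I) = ((r + r ^ 3 / 9 : ℝ) : ℂ) * I := by
    simp only [hNe, mul_pow, I_pow_three]; push_cast; ring
  rw [this, im_ofReal_mul, I_im, mul_one]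

/-- With `ρ = ‖z‖` and `x = z.re`, the gap is `(ρ - x)(1 + ρ²/3 - 4(ρ² + ρx + x²)/9)`, whose second
factor is at least `1 - ρ²`. -/
lemma hNe_re_le {z : ℂ} (hz : ‖z‖ ≤ 1) : (hNe z).re ≤ ‖z‖ - ‖z‖ ^ 3 / 9 := by
  have hx := re_le_norm z
  have hsq : z.im ^ 2 = ‖z‖ ^ 2 - z.re ^ 2 := by
    rw [← normSq_eq_norm_sq, normSq_apply]; ring
  have hre : (hNe z).re = z.re * (1 + ‖z‖ ^ 2 / 3) - 4 * z.re ^ 3 / 9 := by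
    have : (hNe z).re = z.re - (z.re ^ 3 - 3 * z.re * z.im ^ 2) / 9 := by
      simp [hNe, pow_succ]; ring
    rw [this, hsq]; ring
  rw [hre]
  have hρ := norm_nonneg z
  have hxa : z.re ^ 2 ≤ ‖z‖ ^ 2 := by nlinarith [sq_nonneg z.im]
  have h1 : 0 ≤ 1 + ‖z‖ ^ 2 / 3 - 4 / 9 * (‖z‖ ^ 2 + ‖z‖ * z.re + z.re ^ 2) := by nlinarith
  nlinarith [mul_nonneg (sub_nonneg.2 hx) h1]

lemma abs_hNe_re_le {z : ℂ} (hz : ‖z‖ ≤ 1) : |(hNe z).re| ≤ ‖z‖ - ‖z‖ ^ 3 / 9 := by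
  refine abs_le'.2 ⟨hNe_re_le hz, ?_⟩
  have := hNe_re_le (z := -z) (by simpa using hz)
  simpa [hNe_neg] using this

lemma abs_hNe_im_le (z : ℂ) : |(hNe z).im| ≤ ‖z‖ + ‖z‖ ^ 3 / 9 := by
  refine (abs_im_le_norm _).trans ?_
  refine (norm_sub_le _ _).trans ?_
  simp

lemma sub_cube_div_lt {s t : ℝ} (hs : 0 ≤ s) (hst : s < t) (ht : t ≤ 1) :
    s - s ^ 3 / 9 < t - t ^ 3 / 9 := by
  have h : 0 < (t - s) * (1 - (t ^ 2 + t * s + s ^ 2) / 9) :=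
    mul_pos (sub_pos.2 hst) (by nlinarith)
  nlinarith

lemma add_cube_div_lt {s t : ℝ} (hs : 0 ≤ s) (hst : s < t) :
    s + s ^ 3 / 9 < t + t ^ 3 / 9 := by
  have := pow_lt_pow_left₀ hst hs (n := 3) (by norm_num)
  linarith

/-- The imaginary part stays below `10/9 < π` in modulus, so the principal argument does not wrap.
-/
lemma arg_exp_hNe {z : ℂ} (hz : ‖z‖ < 1) : arg (exp (hNe z)) = (hNe z).im := by
  have h := abs_hNe_im_le z
  have h1 := add_cube_div_lt (norm_nonneg z) hz
  have h2 := Real.pi_gt_three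
  rw [abs_le] at h
  rw [← log_im, log_exp] <;> linarith [h.1, h.2]

lemma fNe_ofReal_re (r : ℝ) : (fNe r).re = r * Real.exp (r - r ^ 3 / 9) := by
  rw [fNe_ofReal, ofReal_re]

lemma neg_fNe_neg_re (r : ℝ) : -(fNe (-(r : ℂ))).re = r * Real.exp (-(r - r ^ 3 / 9)) := by
  rw [← ofReal_neg, fNe_ofReal_re]
  ring_nf

lemma norm_eq_mul_exp {f v : ℂ → ℂ} (h0 : f 0 = 0)
    (hfv : ∀ z ∈ disk, divId f z = exp (hNe (v z))) {z : ℂ} (hz : z ∈ disk) :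
    ‖f z‖ = ‖z‖ * Real.exp (hNe (v z)).re := by
  rw [← mul_divId h0 z, hfv z hz, norm_mul, norm_exp]

/-! ### The covering radius -/

lemma abs_exp_sub_lt : |Real.exp (-8 / 9) - 0.411112| < 10 ^ (-6 : ℤ) := by
  have h := Real.exp_bound (x := -8 / 9) (by norm_num [abs_le]) (n := 11) (by norm_num)
  norm_num [Finset.sum_range_succ, Nat.factorial, abs_of_pos, abs_of_neg] at h ⊢
  rw [abs_le] at h
  rw [abs_lt]
  constructor <;> linarith [h.1, h.2]

/-- If an analytic function of the disk fixing `0` satisfies the growth estimate from below, its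
image covers the disk whose radius is the boundary value of the estimate. -/
lemma ball_subset_image {f : ℂ → ℂ} (hf : f ∈ classA)
    (hgrow : ∀ z ∈ disk, ‖z‖ * Real.exp (-(‖z‖ - ‖z‖ ^ 3 / 9)) ≤ ‖f z‖) :
    {w : ℂ | ‖w‖ < Real.exp (-8 / 9)} ⊆ f '' disk := by
  have hA : AnalyticOnNhd ℂ f disk := hf.1.analyticOnNhd isOpen_ball
  have h0 : (0 : ℂ) ∈ disk := mem_ball_self one_pos
  have hopen : IsOpen (f '' disk) := by
    rcases hA.is_constant_or_isOpen (convex_ball (0 : ℂ) 1).isPreconnected with ⟨c, hc⟩ | h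
    · exfalso
      have h2 : f =ᶠ[𝓝 0] fun _ => c :=
        (show EqOn f (fun _ => c) disk from hc).eventuallyEq_of_mem (ball_mem_nhds 0 one_pos)
      have h3 := h2.deriv_eq
      rw [hf.2.2] at h3
      simp at h3
    · exact h disk Subset.rfl isOpen_ball
  have hball : {w : ℂ | ‖w‖ < Real.exp (-8 / 9)} = ball 0 (Real.exp (-8 / 9)) := by
    ext; simp
  rw [hball]
  -- The image is open and contains 0; being relatively closed in the connected ball, it contains
  -- the ball.
  refine (convex_ball (0 : ℂ) _).isPreconnected.subset_of_closure_inter_subset hopen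
    ⟨0, by simpa using Real.exp_pos _, 0, h0, hf.2.1⟩ ?_
  rintro w ⟨hwcl, hw⟩
  rw [mem_ball_zero_iff] at hw
  have hlim : Tendsto (fun s : ℝ => s * Real.exp (-(s - s ^ 3 / 9))) (𝓝 1)
      (𝓝 (Real.exp (-8 / 9))) := by
    have hc : Continuous fun s : ℝ => s * Real.exp (-(s - s ^ 3 / 9)) := by fun_prop
    have := hc.tendsto 1
    norm_num at this ⊢
    exact this
  obtain ⟨m, hwm, hm⟩ := exists_between hw
  obtain ⟨ε, hε, hball⟩ := Metric.eventually_nhds_iff.1 (hlim.eventually (lt_mem_nhds hm))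
  have hK : IsCompact (f '' closedBall 0 (1 - ε)) :=
    (isCompact_closedBall _ _).image_of_continuousOn
      (hf.1.continuousOn.mono (closedBall_subset_ball (by linarith)))
  -- Near the unit circle `‖f z‖` exceeds `m`, so values in `ball 0 m` come from a compact subdisk.
  have hsub : ball 0 m ∩ f '' disk ⊆ f '' closedBall 0 (1 - ε) := by
    rintro _ ⟨hx, z, hz, rfl⟩
    refine ⟨z, ?_, rfl⟩
    have hz1 : ‖z‖ < 1 := mem_ball_zero_iff.1 hz
    rw [mem_closedBall_zero_iff]
    by_contra hcon
    have h1 := hball (y := ‖z‖) (by rw [Real.dist_eq, abs_lt]; constructor <;> linarith)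
    have h2 := hgrow z hz
    rw [mem_ball_zero_iff] at hx
    linarith
  have hw2 : w ∈ closure (ball 0 m ∩ f '' disk) :=
    isOpen_ball.inter_closure ⟨mem_ball_zero_iff.2 hwm, hwcl⟩
  have hw3 := closure_mono hsub hw2
  rw [hK.isClosed.closure_eq] at hw3
  exact image_mono (closedBall_subset_ball (by linarith)) hw3

end Nephroid

open Nephroid Metric

theorem mainTheorem3 (f : ℂ → ℂ) (hf : f ∈ Nephroid.starlikeNe) :
    -- (i) subordination
    (Nephroid.Subordinate (Nephroid.logDerivQuot f) (Nephroid.logDerivQuot Nephroid.fNe) ∧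
      Nephroid.Subordinate (Nephroid.divId f) (Nephroid.divId Nephroid.fNe)) ∧
    -- (ii) growth, with the equality cases of both inequalities
    ((∀ r : ℝ, 0 ≤ r → r < 1 → ∀ z : ℂ, ‖z‖ = r →
        -(Nephroid.fNe (-(r : ℂ))).re ≤ ‖f z‖ ∧ ‖f z‖ ≤ (Nephroid.fNe (r : ℂ)).re) ∧
      (∀ r : ℝ, 0 < r → r < 1 →
        ((∃ z : ℂ, ‖z‖ = r ∧ -(Nephroid.fNe (-(r : ℂ))).re = ‖f z‖) ↔
            Nephroid.IsRotationOf f Nephroid.fNe) ∧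
          ((∃ z : ℂ, ‖z‖ = r ∧ ‖f z‖ = (Nephroid.fNe (r : ℂ)).re) ↔
            Nephroid.IsRotationOf f Nephroid.fNe))) ∧
    -- (iii) covering
    ((-Nephroid.fNe (-1) = ((Real.exp (-8 / 9) : ℝ) : ℂ) ∧
        |Real.exp (-8 / 9) - 0.411112| < 10 ^ (-6 : ℤ)) ∧
      (Nephroid.IsRotationOf f Nephroid.fNe ∨
        {w : ℂ | ‖w‖ < Real.exp (-8 / 9)} ⊆ f '' Nephroid.disk)) ∧
    -- (iv) rotation, with the equality case
    (∀ r : ℝ, 0 ≤ r → r < 1 → ∃ M : ℝ,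
      IsGreatest ((fun ζ : ℂ => Complex.arg (Nephroid.divId Nephroid.fNe ζ)) ''
        {ζ : ℂ | ‖ζ‖ = r}) M ∧
      (∀ z : ℂ, ‖z‖ = r → |Complex.arg (Nephroid.divId f z)| ≤ M) ∧
      (0 < r → ((∃ z : ℂ, ‖z‖ = r ∧ |Complex.arg (Nephroid.divId f z)| = M) ↔
        Nephroid.IsRotationOf f Nephroid.fNe))) := by
  obtain ⟨v, hv, hv0, hv1, hfv⟩ := exists_schwarz hf
  have hA := hf.1
  have h0 : f 0 = 0 := hA.2.1
  have hmem : ∀ {z : ℂ}, ‖z‖ < 1 → z ∈ disk := fun h => mem_ball_zero_iff.2 h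
  have hvle : ∀ {z : ℂ}, ‖z‖ < 1 → ‖v z‖ ≤ ‖z‖ := fun h =>
    Complex.norm_le_norm_of_mapsTo_ball hv (fun y hy => by simpa using (hv1 y hy).le) hv0 h
  have hrot : ∀ {z : ℂ}, 0 < ‖z‖ → ‖z‖ < 1 → ‖v z‖ = ‖z‖ → IsRotationOf f fNe := fun hpos h heq =>
    isRotationOf_of_norm_eq h0 hv hv0 hv1 hfv (hmem h) (norm_pos_iff.1 hpos) heq
  have hre : ∀ {z : ℂ}, ‖z‖ < 1 → |(hNe (v z)).re| ≤ ‖z‖ - ‖z‖ ^ 3 / 9 := fun {z} h => by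
    refine (abs_hNe_re_le (hv1 z (hmem h)).le).trans ?_
    rcases (hvle h).eq_or_lt with heq | hlt
    · rw [heq]
    · exact (sub_cube_div_lt (norm_nonneg _) hlt h.le).le
  have hre_eq : ∀ {z : ℂ}, 0 < ‖z‖ → ‖z‖ < 1 → |(hNe (v z)).re| = ‖z‖ - ‖z‖ ^ 3 / 9 →
      IsRotationOf f fNe := fun {z} hpos h heq => by
    refine hrot hpos h ((hvle h).eq_of_not_lt fun hlt => ?_)
    have h1 := abs_hNe_re_le (hv1 z (hmem h)).le
    have h2 := sub_cube_div_lt (norm_nonneg _) hlt h.le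
    linarith
  have him : ∀ {z : ℂ}, ‖z‖ < 1 → |(hNe (v z)).im| ≤ ‖z‖ + ‖z‖ ^ 3 / 9 := fun {z} h => by
    refine (abs_hNe_im_le _).trans ?_
    have := hvle h
    gcongr
  have him_eq : ∀ {z : ℂ}, 0 < ‖z‖ → ‖z‖ < 1 → |(hNe (v z)).im| = ‖z‖ + ‖z‖ ^ 3 / 9 →
      IsRotationOf f fNe := fun {z} hpos h heq => by
    refine hrot hpos h ((hvle h).eq_of_not_lt fun hlt => ?_)
    have h1 := abs_hNe_im_le (v z)
    have h2 := add_cube_div_lt (norm_nonneg _) hlt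
    linarith
  have hnorm : ∀ {z : ℂ}, ‖z‖ < 1 → ‖f z‖ = ‖z‖ * Real.exp (hNe (v z)).re := fun h =>
    norm_eq_mul_exp h0 hfv (hmem h)
  have hgrowth : ∀ {z : ℂ}, ‖z‖ < 1 → ‖z‖ * Real.exp (-(‖z‖ - ‖z‖ ^ 3 / 9)) ≤ ‖f z‖ ∧
      ‖f z‖ ≤ ‖z‖ * Real.exp (‖z‖ - ‖z‖ ^ 3 / 9) := fun {z} h => by
    have h1 := abs_le.1 (hre h)
    rw [hnorm h]
    constructor <;> gcongr <;> linarith [h1.1, h1.2]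
  have hsubabs : ∀ {s : ℝ}, 0 < s → s < 1 → 0 ≤ s - s ^ 3 / 9 := fun h h1 => by
    have := sub_cube_div_lt le_rfl h h1.le
    norm_num at this
    linarith
  refine ⟨⟨?_, ?_⟩, ⟨fun r _ hr1 z hz => ?_, fun r hr0 hr1 => ⟨⟨?_, ?_⟩, ⟨?_, ?_⟩⟩⟩,
    -- The open disk is covered even when `f` is a rotation, so the second alternative always holds.
    ⟨⟨?_, abs_exp_sub_lt⟩, Or.inr (ball_subset_image hA fun z hz =>
      (hgrowth (mem_ball_zero_iff.1 hz)).1)⟩,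
    -- At `ζ = r I` both terms of `hNe` point along `I`, so the triangle inequality is sharp.
    fun r hr0 hr1 => ⟨r + r ^ 3 / 9, ⟨⟨r * Complex.I, ?_, ?_⟩, ?_⟩, ?_, fun hr => ⟨?_, ?_⟩⟩⟩
  · obtain ⟨-, hq, hphi, w, hw, hw0, hw1, hfw⟩ := hf
    refine ⟨hq, hphi.congr logDerivQuot_fNe, w, hw, hw0, hw1, fun z hz => ?_⟩
    rw [hfw z hz, logDerivQuot_fNe _ (hmem (hw1 z hz))]
  · refine ⟨differentiableOn_divId hA, ?_, v, hv, hv0, hv1, fun z hz => ?_⟩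
    · have : divId fNe = fun z => Complex.exp (hNe z) := funext divId_fNe
      rw [this]
      exact differentiable_hNe.cexp.differentiableOn
    · rw [hfv z hz, divId_fNe]
  · subst hz
    rw [neg_fNe_neg_re, fNe_ofReal_re]
    exact hgrowth hr1
  · rintro ⟨z, rfl, h⟩
    rw [neg_fNe_neg_re, hnorm hr1, mul_right_inj' hr0.ne', Real.exp_eq_exp] at h
    refine hre_eq hr0 hr1 ?_
    rw [← h, abs_neg, abs_of_nonneg (hsubabs hr0 hr1)]
  · intro h
    obtain ⟨c, hc, h⟩ := h.exists_divId
    have hc0 : c ≠ 0 := norm_ne_zero_iff.1 (by rw [hc]; exact one_ne_zero)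
    -- A rotation has `v z = c z`; this point is sent to `-r`, where the lower bound is attained.
    have hz : ‖c⁻¹ * -(r : ℂ)‖ = r := by simp [hc, abs_of_pos hr0]
    refine ⟨_, hz, ?_⟩
    rw [neg_fNe_neg_re, norm_eq_mul_exp (v := fun z => c * z) h0 h (hmem (by rw [hz]; exact hr1)),
      hz, mul_inv_cancel_left₀ hc0, hNe_neg, Complex.neg_re, hNe_ofReal_re]
  · rintro ⟨z, rfl, h⟩
    rw [fNe_ofReal_re, hnorm hr1, mul_right_inj' hr0.ne', Real.exp_eq_exp] at h
    refine hre_eq hr0 hr1 ?_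
    rw [h, abs_of_nonneg (hsubabs hr0 hr1)]
  · intro h
    obtain ⟨c, hc, h⟩ := h.exists_divId
    have hc0 : c ≠ 0 := norm_ne_zero_iff.1 (by rw [hc]; exact one_ne_zero)
    have hz : ‖c⁻¹ * (r : ℂ)‖ = r := by simp [hc, abs_of_pos hr0]
    refine ⟨_, hz, ?_⟩
    rw [fNe_ofReal_re, norm_eq_mul_exp (v := fun z => c * z) h0 h (hmem (by rw [hz]; exact hr1)),
      hz, mul_inv_cancel_left₀ hc0, hNe_ofReal_re]
  · have := fNe_ofReal (-1)
    push_cast at this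
    rw [this]
    norm_num
  · simp [abs_of_nonneg hr0]
  · have : ‖(r * Complex.I : ℂ)‖ < 1 := by simpa [abs_of_nonneg hr0] using hr1
    simp only [divId_fNe, arg_exp_hNe this, hNe_mul_I_im]
  · rintro _ ⟨ζ, rfl, rfl⟩
    simp only [divId_fNe, arg_exp_hNe hr1]
    exact (le_abs_self _).trans (abs_hNe_im_le ζ)
  · rintro z rfl
    rw [hfv z (hmem hr1), arg_exp_hNe (hv1 z (hmem hr1))]
    exact him hr1
  · rintro ⟨z, rfl, h⟩
    rw [hfv z (hmem hr1), arg_exp_hNe (hv1 z (hmem hr1))] at h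
    exact him_eq hr hr1 h
  · intro h
    obtain ⟨c, hc, h⟩ := h.exists_divId
    have hc0 : c ≠ 0 := norm_ne_zero_iff.1 (by rw [hc]; exact one_ne_zero)
    have hz : ‖c⁻¹ * (r * Complex.I : ℂ)‖ = r := by simp [hc, abs_of_pos hr]
    refine ⟨_, hz, ?_⟩
    have h1 : ‖(r * Complex.I : ℂ)‖ < 1 := by simpa [abs_of_nonneg hr0] using hr1
    rw [h _ (hmem (by rw [hz]; exact hr1)), mul_inv_cancel_left₀ hc0, arg_exp_hNe h1,
      hNe_mul_I_im, abs_of_nonneg (by positivity)]
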